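/- There is an absolute constant $C>0$ such that for every integer $N\ge 1$ there is a probability distribution $(\mathcal G,\mathcal H_N)$ on $\mathbb R^2$ with the following properties. The first marginal $\mathcal G$ is the standard Gaussian $N(0,1)$, and the second marginal $\mathcal H_N$ is the distribution of $\sum_{i=1}^N b_i$, where $b_1,\dots,b_N$ are independent uniform random bits from $\{-1,1\}$. The coupling is by quantile matching: if $\Psi$ and $F_N$ denote the cumulative distribution functions of $\mathcal G$ and $\mathcal H_N$, then almost surely $F_N(\mathcal H_N-2)<\Psi(\mathcal G)\le F_N(\mathcal H_N)$. Moreover $\mathcal G$ and $\mathcal H_N/\sqrt N$ are pointwise close: $$\Pr\Big[\,\Big|\mathcal G-\frac{\mathcal H_N}{\sqrt N}\Big|\le C\,N^{-1/4}\Big]\ \ge\ 1-C\,N^{-1/4}.$$ -/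

import Mathlib

open MeasureTheory ProbabilityTheory

/-- The law of a uniform random bit with values in `{-1, 1}`, as a measure on `ℝ`. -/
noncomputable def signBit : Measure ℝ :=
  (2⁻¹ : ENNReal) • Measure.dirac (-1) + (2⁻¹ : ENNReal) • Measure.dirac 1

instance instIsProbabilityMeasureSignBit : IsProbabilityMeasure signBit := by
  constructor
  simp [signBit, ENNReal.inv_two_add_inv_two]

/-- The law of `b₁ + ⋯ + b_N`, where the `b_i` are independent uniform bits from `{-1, 1}`. -/
noncomputable def bitSumLaw (N : ℕ) : Measure ℝ :=
  (Measure.pi fun _ : Fin N => signBit).map fun b => ∑ i, b i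

instance instIsProbabilityMeasureBitSumLaw (N : ℕ) : IsProbabilityMeasure (bitSumLaw N) :=
  Measure.isProbabilityMeasure_map (by fun_prop)

/-- A measure on `ℝ × ℝ` is a coupling of `μ` and `ν` if it is a probability measure with first
marginal `μ` and second marginal `ν`. -/
structure IsCoupling (γ : Measure (ℝ × ℝ)) (μ ν : Measure ℝ) : Prop where
  isProbabilityMeasure : IsProbabilityMeasure γ
  fst_eq : γ.fst = μ
  snd_eq : γ.snd = ν

/-- The coupling `γ` of the standard Gaussian with the sum of `N` random bits matches quantiles:
almost surely the Gaussian coordinate `g` lies in the interval of quantiles that belongs to the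
value `h` of the sum, namely `F_N (h - 2) < Ψ g ≤ F_N h` for the distribution functions `Ψ` of the
Gaussian and `F_N` of the sum. (The values of the sum are spaced by `2`.) -/
def MatchesQuantiles (N : ℕ) (γ : Measure (ℝ × ℝ)) : Prop :=
  ∀ᵐ p ∂γ, cdf (bitSumLaw N) (p.2 - 2) < cdf (gaussianReal 0 1) p.1 ∧
    cdf (gaussianReal 0 1) p.1 ≤ cdf (bitSumLaw N) p.2

/-! Take `h` to be the quantile transform of the Gaussian `g`; both marginals and the quantile
inequalities then follow from `gaussianTransport_le_iff`. For closeness, Berry-Esseen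
(`abs_cdf_bitSumLaw_sub_le`) gives `|Ψ g - Ψ (h / √N)| ≤ 46 / √N`. Inverting `Ψ` costs a factor
1/density, and the density is at least a sixth of the smaller tail. Outside an event of mass
`O(N^(-1/4))` the tail at `g` is of order at least `N^(-1/4)`, so the distance is `O(N^(-1/2) /
N^(-1/4)) = O(N^(-1/4))`.

Berry-Esseen is proved by Stein's method. With `f` the Stein solution and `W` the normalized sum,
the error is `E[f' W - W * f W]`. Discrete integration by parts (`bitMean_mul_self`) turns `E[W * f
W]` into an expected difference quotient of `f`. This is close to `f'` except near the kink of `f`,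
where the walk rarely is (`bitMean_indicator_Icc_le`). -/

/-! ### Expectations over sums of random bits -/

/-- The expectation of `f (b₁ + ⋯ + b_n)` for independent uniform bits `b_i` in `{-1, 1}`. -/
noncomputable def bitMean : ℕ → (ℝ → ℝ) → ℝ
  | 0, f => f 0
  | n + 1, f => (bitMean n (fun s => f (s + 1)) + bitMean n (fun s => f (s - 1))) / 2

lemma bitMean_succ (n : ℕ) (f : ℝ → ℝ) :
    bitMean (n + 1) f = (bitMean n (fun s => f (s + 1)) + bitMean n (fun s => f (s - 1))) / 2 :=
  rfl

lemma bitMean_add (n : ℕ) (f g : ℝ → ℝ) :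
    bitMean n (fun s => f s + g s) = bitMean n f + bitMean n g := by
  induction n generalizing f g with
  | zero => rfl
  | succ n ih => simp only [bitMean_succ, ih]; ring

lemma bitMean_const_mul (n : ℕ) (c : ℝ) (f : ℝ → ℝ) :
    bitMean n (fun s => c * f s) = c * bitMean n f := by
  induction n generalizing f with
  | zero => rfl
  | succ n ih => simp only [bitMean_succ, ih]; ring

lemma bitMean_const (n : ℕ) (c : ℝ) : bitMean n (fun _ => c) = c := by
  induction n with
  | zero => rfl
  | succ n ih => simp only [bitMean_succ, ih]; ring

lemma bitMean_mono (n : ℕ) {f g : ℝ → ℝ} (h : ∀ s, f s ≤ g s) : bitMean n f ≤ bitMean n g := by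
  induction n generalizing f g with
  | zero => exact h 0
  | succ n ih =>
    simp only [bitMean_succ]
    have h1 := ih (fun s => h (s + 1))
    have h2 := ih (fun s => h (s - 1))
    linarith

lemma bitMean_sub (n : ℕ) (f g : ℝ → ℝ) :
    bitMean n (fun s => f s - g s) = bitMean n f - bitMean n g := by
  have := bitMean_add n (fun s => f s - g s) g
  simp only [sub_add_cancel] at this
  linarith

lemma bitMean_div_const (n : ℕ) (f : ℝ → ℝ) (c : ℝ) :
    bitMean n (fun s => f s / c) = bitMean n f / c := by
  have := bitMean_const_mul n c⁻¹ f
  simp only [div_eq_inv_mul, this]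

lemma bitMean_succ' (n : ℕ) (f : ℝ → ℝ) :
    bitMean (n + 1) f = bitMean n (fun s => (f (s + 1) + f (s - 1)) / 2) := by
  rw [bitMean_div_const, bitMean_add, bitMean_succ]

lemma abs_bitMean_le (n : ℕ) {f g : ℝ → ℝ} (h : ∀ s, |f s| ≤ g s) : |bitMean n f| ≤ bitMean n g := by
  rw [abs_le]
  constructor
  · have := bitMean_mono n (f := fun s => (-1) * g s) (g := f)
      (fun s => by linarith [(abs_le.1 (h s)).1])
    rw [bitMean_const_mul] at this
    linarith
  · exact bitMean_mono n fun s => (abs_le.1 (h s)).2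

/-- Discrete integration by parts for sums of random bits. -/
lemma bitMean_mul_self (n : ℕ) (h : ℝ → ℝ) :
    bitMean (n + 1) (fun s => s * h s) =
      (n + 1) * bitMean n (fun s => (h (s + 1) - h (s - 1)) / 2) := by
  induction n generalizing h with
  | zero => simp [bitMean]; ring
  | succ n ih =>
    -- Averaging over one bit gives `s` times the averaged `h`, to which the induction hypothesis
    -- applies, plus the one extra summand that raises the factor by 1.
    have key : ∀ s : ℝ, ((s + 1) * h (s + 1) + (s - 1) * h (s - 1)) / 2 =
        s * ((h (s + 1) + h (s - 1)) / 2) + (h (s + 1) - h (s - 1)) / 2 := fun s => by ring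
    rw [bitMean_succ']
    simp only [key]
    rw [bitMean_add, ih (fun s => (h (s + 1) + h (s - 1)) / 2),
      bitMean_succ' n (fun s => (h (s + 1) - h (s - 1)) / 2)]
    have key2 : ∀ s : ℝ, ((h (s + 1 + 1) + h (s + 1 - 1)) / 2 - (h (s - 1 + 1) + h (s - 1 - 1)) / 2) / 2
        = ((h (s + 1 + 1) - h (s + 1 - 1)) / 2 + (h (s - 1 + 1) - h (s - 1 - 1)) / 2) / 2 := fun s => by
      rw [show s + 1 - 1 = s - 1 + 1 by ring]; ring
    simp only [key2]
    push_cast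
    ring

lemma bitMean_sq (n : ℕ) : bitMean n (fun s => s * s) = n := by
  cases n with
  | zero => simp [bitMean]
  | succ n =>
    rw [bitMean_mul_self n (fun s => s)]
    have : ∀ s : ℝ, (s + 1 - (s - 1)) / 2 = 1 := fun s => by ring
    simp only [this, bitMean_const]
    push_cast; ring

lemma bitMean_abs_le (n : ℕ) : bitMean n (fun s => |s|) ≤ √n := by
  rcases Nat.eq_zero_or_pos n with rfl | hn
  · simp [bitMean]
  have hc : 0 < √(n : ℝ) := Real.sqrt_pos.2 (by exact_mod_cast hn)
  have hcc : √(n : ℝ) * √(n : ℝ) = n := Real.mul_self_sqrt n.cast_nonneg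
  -- AM-GM with weight `√n` stands in for Cauchy-Schwarz.
  have h1 : bitMean n (fun s => |s|) ≤ bitMean n (fun s => s * s / (2 * √n) + √n / 2) := by
    refine bitMean_mono n fun s => ?_
    have h2 := sq_nonneg (|s| - √n)
    have h3 : s * s / (2 * √n) + √n / 2 - |s| = (|s| - √n) ^ 2 / (2 * √n) := by
      rw [← abs_mul_abs_self s]; field_simp; ring
    have : 0 ≤ (|s| - √n) ^ 2 / (2 * √(n : ℝ)) := by positivity
    linarith
  rw [bitMean_add, bitMean_div_const, bitMean_const, bitMean_sq] at h1
  have : (n : ℝ) / (2 * √n) = √n / 2 := by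
    rw [div_eq_div_iff (by positivity) two_ne_zero]; nlinarith
  linarith

/-- Anti-concentration: no interval of length `2` carries more than `3 / √n` of the law. -/
lemma bitMean_indicator_Icc_le (n : ℕ) (y : ℝ) :
    bitMean (n + 1) ((Set.Icc (y - 1) (y + 1)).indicator 1) ≤ 3 / √(n + 1 : ℝ) := by
  -- The truncated identity has slope 1 within 3 of `y`, so its central difference dominates the
  -- indicator averaged over one bit. As it is bounded by 3, integration by parts gives `(n + 1) *
  -- E[difference] ≤ 3 * E|S| ≤ 3 * √(n + 1)`.
  set h : ℝ → ℝ := fun s => max (-3) (min (s - y) 3) with hdef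
  have hmono : Monotone h := fun a b hab => by
    simp only [hdef]; gcongr
  have hlin : ∀ s, y - 3 ≤ s → s ≤ y + 3 → h s = s - y := fun s h1 h2 => by
    simp only [hdef]
    rw [min_eq_left (by linarith), max_eq_right (by linarith)]
  have habs : ∀ s, |h s| ≤ 3 := fun s =>
    abs_le.2 ⟨le_max_left _ _, max_le (by norm_num) (min_le_right _ _)⟩
  have h1 : bitMean (n + 1) ((Set.Icc (y - 1) (y + 1)).indicator 1) ≤
      bitMean n (fun s => (h (s + 1) - h (s - 1)) / 2) := by
    rw [bitMean_succ']
    refine bitMean_mono n fun s => ?_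
    have hle : ∀ t : ℝ, (Set.Icc (y - 1) (y + 1)).indicator (1 : ℝ → ℝ) t ≤ 1 := fun t =>
      Set.indicator_le_self' (fun _ _ => zero_le_one) t
    by_cases hs : y - 2 ≤ s ∧ s ≤ y + 2
    · rw [hlin _ (by linarith) (by linarith), hlin _ (by linarith) (by linarith)]
      linarith [hle (s + 1), hle (s - 1)]
    · rw [Set.indicator_of_notMem, Set.indicator_of_notMem]
      · have := hmono (show s - 1 ≤ s + 1 by linarith)
        simp only [add_zero, zero_div]; linarith
      · rintro ⟨a, b⟩; exact hs ⟨by linarith, by linarith⟩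
      · rintro ⟨a, b⟩; exact hs ⟨by linarith, by linarith⟩
  have hpos : (0 : ℝ) < n + 1 := by positivity
  have hc : 0 < √(n + 1 : ℝ) := Real.sqrt_pos.2 hpos
  have hcc : √(n + 1 : ℝ) * √(n + 1 : ℝ) = n + 1 := Real.mul_self_sqrt hpos.le
  have h2 : bitMean (n + 1) (fun s => s * h s) ≤ 3 * √(n + 1 : ℝ) := by
    have h3 : bitMean (n + 1) (fun s => s * h s) ≤ bitMean (n + 1) (fun s => 3 * |s|) := by
      refine bitMean_mono _ fun s => (le_abs_self _).trans ?_
      rw [abs_mul, mul_comm]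
      exact mul_le_mul_of_nonneg_right (habs s) (abs_nonneg s)
    rw [bitMean_const_mul] at h3
    have h4 := bitMean_abs_le (n + 1)
    push_cast at h4
    linarith
  rw [bitMean_mul_self] at h2
  refine h1.trans ?_
  rw [le_div_iff₀ hc]
  have h5 : √(n + 1 : ℝ) * (bitMean n (fun s => (h (s + 1) - h (s - 1)) / 2) * √(n + 1 : ℝ)) ≤
      √(n + 1 : ℝ) * 3 := by
    calc _ = √(n + 1 : ℝ) * √(n + 1 : ℝ) * bitMean n (fun s => (h (s + 1) - h (s - 1)) / 2) := by ring
      _ ≤ _ := by rw [hcc]; linarith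
  exact le_of_mul_le_mul_left h5 hc

/-! ### The law of the bit sum in terms of `bitMean` -/

lemma bitSumLaw_zero : bitSumLaw 0 = Measure.dirac 0 := by
  simp [bitSumLaw, Measure.map_const]

lemma bitSumLaw_succ_apply (n : ℕ) {A : Set ℝ} (hA : MeasurableSet A) :
    bitSumLaw (n + 1) A =
      2⁻¹ * bitSumLaw n ((fun s => s - 1) ⁻¹' A) + 2⁻¹ * bitSumLaw n ((fun s => s + 1) ⁻¹' A) := by
  have hmp := measurePreserving_piFinSuccAbove (n := n) (fun _ => signBit) 0
  have hm : Measurable fun p : ℝ × (Fin n → ℝ) => p.1 + ∑ i, p.2 i := by fun_prop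
  have h1 : bitSumLaw (n + 1) = (signBit.prod (Measure.pi fun _ : Fin n => signBit)).map
      fun p => p.1 + ∑ i, p.2 i := by
    rw [← hmp.map_eq, Measure.map_map hm hmp.measurable, bitSumLaw]
    congr 1
    ext b
    simp [Fin.sum_univ_succ, MeasurableEquiv.piFinSuccAbove, Fin.tail]
  have hm2 : Measurable fun b : Fin n → ℝ => ∑ i, b i := by fun_prop
  rw [h1, Measure.map_apply hm hA, Measure.prod_apply (hm hA), signBit, lintegral_add_measure,
    lintegral_smul_measure, lintegral_smul_measure, lintegral_dirac, lintegral_dirac, bitSumLaw,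
    Measure.map_apply hm2 (hA.preimage (by fun_prop)),
    Measure.map_apply hm2 (hA.preimage (by fun_prop))]
  congr 3
  ext b
  simp [sub_eq_neg_add]
  ext b
  simp [add_comm]

lemma bitSumLaw_real (n : ℕ) {A : Set ℝ} (hA : MeasurableSet A) :
    (bitSumLaw n).real A = bitMean n (A.indicator 1) := by
  induction n generalizing A with
  | zero =>
    rw [bitSumLaw_zero, Measure.real, Measure.dirac_apply' _ hA, bitMean]
    by_cases h : (0 : ℝ) ∈ A <;> simp [h]
  | succ n ih =>
    rw [Measure.real, bitSumLaw_succ_apply n hA,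
      ENNReal.toReal_add (by finiteness) (by finiteness), ENNReal.toReal_mul, ENNReal.toReal_mul,
      ← Measure.real, ← Measure.real, ih (hA.preimage (by fun_prop)),
      ih (hA.preimage (by fun_prop)), bitMean_succ]
    have e1 : ((fun s : ℝ => s + 1) ⁻¹' A).indicator (1 : ℝ → ℝ) =
      fun s => A.indicator 1 (s + 1) := rfl
    have e2 : ((fun s : ℝ => s - 1) ⁻¹' A).indicator (1 : ℝ → ℝ) =
      fun s => A.indicator 1 (s - 1) := rfl
    rw [e1, e2]
    simp only [ENNReal.toReal_inv, ENNReal.toReal_ofNat]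
    ring

lemma cdf_bitSumLaw (n : ℕ) (x : ℝ) :
    cdf (bitSumLaw n) x = bitMean n ((Set.Iic x).indicator 1) := by
  rw [cdf_eq_real, bitSumLaw_real n measurableSet_Iic]

/-! ### Density, distribution function and tails of the Gaussian -/

lemma gaussianPDFReal_std (w : ℝ) :
    gaussianPDFReal 0 1 w = (√(2 * Real.pi))⁻¹ * Real.exp (-w ^ 2 / 2) := by
  simp [gaussianPDFReal]

lemma hasDerivAt_gaussianPDFReal_std (w : ℝ) :
    HasDerivAt (gaussianPDFReal 0 1) (-(w * gaussianPDFReal 0 1 w)) w := by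
  have h0 : gaussianPDFReal 0 1 = fun w => (√(2 * Real.pi))⁻¹ * Real.exp (-w ^ 2 / 2) :=
    funext gaussianPDFReal_std
  rw [h0]
  have h1 : HasDerivAt (fun w : ℝ => -w ^ 2 / 2) (-w) w := by
    have := (hasDerivAt_pow 2 w).fun_neg.div_const 2
    exact this.congr_deriv (by push_cast; ring)
  have h2 := (h1.exp).const_mul (√(2 * Real.pi))⁻¹
  exact h2.congr_deriv (by ring)

lemma continuous_gaussianPDFReal_std : Continuous (gaussianPDFReal 0 1) :=
  continuous_iff_continuousAt.2 fun w => (hasDerivAt_gaussianPDFReal_std w).continuousAt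

lemma gaussianPDFReal_std_pos (w : ℝ) : 0 < gaussianPDFReal 0 1 w :=
  gaussianPDFReal_pos 0 1 w one_ne_zero

lemma gaussianPDFReal_std_le_one (w : ℝ) : gaussianPDFReal 0 1 w ≤ 1 := by
  rw [gaussianPDFReal_std]
  refine mul_le_one₀ (inv_le_one_of_one_le₀ ?_) (Real.exp_pos _).le ?_
  · rw [Real.one_le_sqrt]; linarith [Real.pi_gt_three]
  · rw [Real.exp_le_one_iff]; nlinarith [sq_nonneg w]

lemma cdf_gaussianReal_std (w : ℝ) :
    cdf (gaussianReal 0 1) w = ∫ t in Set.Iic w, gaussianPDFReal 0 1 t := by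
  rw [cdf_eq_real, Measure.real, gaussianReal_apply_eq_integral 0 one_ne_zero,
    ENNReal.toReal_ofReal (integral_nonneg fun t => gaussianPDFReal_nonneg 0 1 t)]

lemma one_sub_cdf_gaussianReal_std (w : ℝ) :
    1 - cdf (gaussianReal 0 1) w = ∫ t in Set.Ioi w, gaussianPDFReal 0 1 t := by
  have h := intervalIntegral.integral_Iic_add_Ioi (b := w)
    (integrable_gaussianPDFReal 0 1).integrableOn (integrable_gaussianPDFReal 0 1).integrableOn
  rw [integral_gaussianPDFReal_eq_one 0 one_ne_zero] at h
  rw [cdf_gaussianReal_std]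
  linarith

lemma hasDerivAt_cdf_gaussianReal_std (w : ℝ) :
    HasDerivAt (fun x => cdf (gaussianReal 0 1) x) (gaussianPDFReal 0 1 w) w := by
  have h : (fun x => cdf (gaussianReal 0 1) x) =
      fun x => cdf (gaussianReal 0 1) 0 + ∫ t in (0 : ℝ)..x, gaussianPDFReal 0 1 t := by
    ext x
    rw [cdf_gaussianReal_std, cdf_gaussianReal_std, ← intervalIntegral.integral_Iic_sub_Iic
      (integrable_gaussianPDFReal 0 1).integrableOn (integrable_gaussianPDFReal 0 1).integrableOn]
    ring
  rw [h]
  exact (continuous_gaussianPDFReal_std.integral_hasStrictDerivAt 0 w).hasDerivAt.const_add _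

lemma continuous_cdf_gaussianReal_std : Continuous fun x => cdf (gaussianReal 0 1) x :=
  continuous_iff_continuousAt.2 fun w => (hasDerivAt_cdf_gaussianReal_std w).continuousAt

lemma strictMono_cdf_gaussianReal_std : StrictMono fun x => cdf (gaussianReal 0 1) x :=
  strictMono_of_hasDerivAt_pos hasDerivAt_cdf_gaussianReal_std gaussianPDFReal_std_pos

lemma cdf_gaussianReal_std_pos (w : ℝ) : 0 < cdf (gaussianReal 0 1) w :=
  (cdf_nonneg _ (w - 1)).trans_lt (strictMono_cdf_gaussianReal_std (by linarith : w - 1 < w))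

lemma cdf_gaussianReal_std_lt_one (w : ℝ) : cdf (gaussianReal 0 1) w < 1 :=
  (strictMono_cdf_gaussianReal_std (by linarith : w < w + 1)).trans_le (cdf_le_one _ (w + 1))

lemma cdf_gaussianReal_std_neg (w : ℝ) :
    cdf (gaussianReal 0 1) (-w) = 1 - cdf (gaussianReal 0 1) w := by
  rw [one_sub_cdf_gaussianReal_std, cdf_gaussianReal_std]
  have := integral_comp_neg_Iic (-w) (gaussianPDFReal 0 1)
  rw [neg_neg] at this
  rw [← this]
  simp [gaussianPDFReal_std]

/-- The Gaussian tail bound of Mills. -/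
lemma mul_one_sub_cdf_gaussianReal_std_le {w : ℝ} (hw : 0 ≤ w) :
    w * (1 - cdf (gaussianReal 0 1) w) ≤ gaussianPDFReal 0 1 w := by
  have hlim : Filter.Tendsto (fun t => -gaussianPDFReal 0 1 t) Filter.atTop (nhds 0) := by
    have h1 : Filter.Tendsto (fun w : ℝ => -w ^ 2 / 2) Filter.atTop Filter.atBot := by
      have := (Filter.tendsto_pow_atTop (α := ℝ) two_ne_zero).atTop_div_const (two_pos (α := ℝ))
      refine (Filter.tendsto_neg_atTop_atBot.comp this).congr fun x => ?_
      simp only [Function.comp]; ring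
    have h2 := ((Real.tendsto_exp_atBot.comp h1).const_mul (√(2 * Real.pi))⁻¹).neg
    rw [mul_zero, neg_zero] at h2
    exact h2.congr fun x => by rw [gaussianPDFReal_std]; rfl
  -- The integral of `t * φ t` over `(w, ∞)` is exactly `φ w`, and `w ≤ t` there.
  have hderiv : ∀ t ∈ Set.Ici w,
      HasDerivAt (fun t => -gaussianPDFReal 0 1 t) (t * gaussianPDFReal 0 1 t) t := fun t _ => by
    simpa using (hasDerivAt_gaussianPDFReal_std t).fun_neg
  have hnn : ∀ t ∈ Set.Ioi w, 0 ≤ t * gaussianPDFReal 0 1 t := fun t ht =>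
    mul_nonneg (hw.trans (le_of_lt ht)) (gaussianPDFReal_nonneg 0 1 t)
  have hint := integrableOn_Ioi_deriv_of_nonneg' hderiv hnn hlim
  have heq := integral_Ioi_of_hasDerivAt_of_nonneg' hderiv hnn hlim
  rw [one_sub_cdf_gaussianReal_std, ← integral_const_mul]
  calc ∫ t in Set.Ioi w, w * gaussianPDFReal 0 1 t
      ≤ ∫ t in Set.Ioi w, t * gaussianPDFReal 0 1 t := by
        refine setIntegral_mono_on ((integrable_gaussianPDFReal 0 1).const_mul w).integrableOn hint
          measurableSet_Ioi fun t ht => ?_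
        exact mul_le_mul_of_nonneg_right (le_of_lt ht) (gaussianPDFReal_nonneg 0 1 t)
    _ = gaussianPDFReal 0 1 w := by rw [heq]; ring

/-- Mills' bound suffices for `w ≥ 1`; on `[0, 1]` the density is at least `1/6`, from `√(2π) ≤ 3`
and `exp (-1/2) ≥ 1/2`. -/
lemma one_sub_cdf_gaussianReal_std_le {w : ℝ} (hw : 0 ≤ w) :
    1 - cdf (gaussianReal 0 1) w ≤ 6 * gaussianPDFReal 0 1 w := by
  have h0 := cdf_gaussianReal_std_pos w
  rcases le_total 1 w with h | h
  · have h1 := mul_one_sub_cdf_gaussianReal_std_le hw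
    have h2 := cdf_gaussianReal_std_lt_one w
    nlinarith [gaussianPDFReal_std_pos w]
  · have h1 : (1 : ℝ) / 6 ≤ gaussianPDFReal 0 1 w := by
      rw [gaussianPDFReal_std]
      have h2 : √(2 * Real.pi) ≤ 3 := by
        rw [Real.sqrt_le_left (by norm_num)]; linarith [Real.pi_lt_d2]
      have h3 : (3 : ℝ)⁻¹ ≤ (√(2 * Real.pi))⁻¹ :=
        inv_anti₀ (Real.sqrt_pos.2 (by positivity)) h2
      have h4 : (1 : ℝ) / 2 ≤ Real.exp (-w ^ 2 / 2) := by
        have := Real.add_one_le_exp (-w ^ 2 / 2)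
        nlinarith
      calc (1 : ℝ) / 6 = 3⁻¹ * (1 / 2) := by norm_num
        _ ≤ _ := by gcongr
    linarith

/-- The smaller one of the two tails of the standard Gaussian at `w`. -/
noncomputable def gaussianTail (w : ℝ) : ℝ :=
  min (cdf (gaussianReal 0 1) w) (1 - cdf (gaussianReal 0 1) w)

lemma gaussianTail_le (w : ℝ) : gaussianTail w ≤ 6 * gaussianPDFReal 0 1 w := by
  rcases le_total 0 w with h | h
  · exact (min_le_right _ _).trans (one_sub_cdf_gaussianReal_std_le h)
  · have := one_sub_cdf_gaussianReal_std_le (neg_nonneg.2 h)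
    rw [← cdf_gaussianReal_std_neg, neg_neg] at this
    refine (min_le_left _ _).trans (this.trans_eq ?_)
    simp [gaussianPDFReal_std]

lemma abs_mul_gaussianTail_le (w : ℝ) : |w| * gaussianTail w ≤ gaussianPDFReal 0 1 w := by
  rcases le_total 0 w with h | h
  · rw [abs_of_nonneg h]
    exact (mul_le_mul_of_nonneg_left (min_le_right _ _) h).trans
      (mul_one_sub_cdf_gaussianReal_std_le h)
  · rw [abs_of_nonpos h]
    have := mul_one_sub_cdf_gaussianReal_std_le (neg_nonneg.2 h)
    rw [← cdf_gaussianReal_std_neg, neg_neg] at this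
    refine (mul_le_mul_of_nonneg_left (min_le_left _ _) (neg_nonneg.2 h)).trans
      (this.trans_eq ?_)
    simp [gaussianPDFReal_std]

/-! ### Stein's equation -/

/-- The solution of Stein's equation `f' w - w * f w = 1_{w ≤ x} - Ψ x`. -/
noncomputable def steinSol (x w : ℝ) : ℝ :=
  if w ≤ x then
    cdf (gaussianReal 0 1) w / gaussianPDFReal 0 1 w * (1 - cdf (gaussianReal 0 1) x)
  else (1 - cdf (gaussianReal 0 1) w) / gaussianPDFReal 0 1 w * cdf (gaussianReal 0 1) x

/-- The derivative of `steinSol x`, as Stein's equation gives it. -/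
noncomputable def steinDeriv (x w : ℝ) : ℝ :=
  w * steinSol x w + ((Set.Iic x).indicator 1 w - cdf (gaussianReal 0 1) x)

lemma steinSol_nonneg (x w : ℝ) : 0 ≤ steinSol x w := by
  have h1 := gaussianPDFReal_std_pos w
  have h2 := cdf_gaussianReal_std_pos w
  have h3 := cdf_gaussianReal_std_pos x
  have h4 := sub_pos.2 (cdf_gaussianReal_std_lt_one w)
  have h5 := sub_pos.2 (cdf_gaussianReal_std_lt_one x)
  unfold steinSol
  split_ifs <;> positivity

/-- For `w ≤ x` the product `Ψ w * (1 - Ψ x)` is at most `Ψ w` and, by monotonicity, at most `1 - Ψ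
w`; the other case is symmetric. The bound no longer involves `x`, which makes the later estimates
uniform. -/
lemma steinSol_le_tail (x w : ℝ) : steinSol x w ≤ gaussianTail w / gaussianPDFReal 0 1 w := by
  have h1 := gaussianPDFReal_std_pos w
  have h2 := cdf_gaussianReal_std_pos w
  have h3 := cdf_gaussianReal_std_pos x
  have h4 := sub_pos.2 (cdf_gaussianReal_std_lt_one w)
  have h5 := sub_pos.2 (cdf_gaussianReal_std_lt_one x)
  unfold steinSol
  split_ifs with h
  · have h6 := monotone_cdf (gaussianReal 0 1) h
    rw [div_mul_eq_mul_div]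
    gcongr
    exact le_min (by nlinarith) (by nlinarith)
  · have h6 := monotone_cdf (gaussianReal 0 1) (not_le.1 h).le
    rw [div_mul_eq_mul_div]
    gcongr
    exact le_min (by nlinarith) (by nlinarith)

lemma steinSol_le (x w : ℝ) : steinSol x w ≤ 6 :=
  (steinSol_le_tail x w).trans <| (div_le_iff₀ (gaussianPDFReal_std_pos w)).2 (gaussianTail_le w)

lemma abs_mul_steinSol_le (x w : ℝ) : |w * steinSol x w| ≤ 1 := by
  rw [abs_mul, abs_of_nonneg (steinSol_nonneg x w)]
  refine (mul_le_mul_of_nonneg_left (steinSol_le_tail x w) (abs_nonneg w)).trans ?_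
  rw [← mul_div_assoc]
  exact (div_le_one (gaussianPDFReal_std_pos w)).2 (abs_mul_gaussianTail_le w)

lemma abs_steinDeriv_le (x w : ℝ) : |steinDeriv x w| ≤ 2 := by
  have h1 : |(Set.Iic x).indicator 1 w - cdf (gaussianReal 0 1) x| ≤ 1 := by
    have h2 := cdf_nonneg (gaussianReal 0 1) x
    have h3 := cdf_le_one (gaussianReal 0 1) x
    by_cases h : w ∈ Set.Iic x
    · rw [Set.indicator_of_mem h, abs_le]; constructor <;> simp <;> linarith
    · rw [Set.indicator_of_notMem h, abs_le]; constructor <;> linarith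
  refine (abs_add_le _ _).trans ?_
  linarith [abs_mul_steinSol_le x w]

lemma continuous_steinSol (x : ℝ) : Continuous (steinSol x) := by
  have h0 : ∀ w, gaussianPDFReal 0 1 w ≠ 0 := fun w => (gaussianPDFReal_std_pos w).ne'
  have h1 := continuous_cdf_gaussianReal_std
  have h2 := continuous_gaussianPDFReal_std
  refine Continuous.if_le ?_ ?_ continuous_id continuous_const ?_
  · exact (h1.div h2 h0).mul continuous_const
  · exact ((continuous_const.sub h1).div h2 h0).mul continuous_const
  · rintro w rfl; ring

lemma hasDerivAt_steinSol {x w : ℝ} (h : w ≠ x) : HasDerivAt (steinSol x) (steinDeriv x w) w := by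
  have h0 := (gaussianPDFReal_std_pos w).ne'
  have h1 := hasDerivAt_cdf_gaussianReal_std w
  have h2 := hasDerivAt_gaussianPDFReal_std w
  rcases h.lt_or_gt with h | h
  · have h3 := (h1.div h2 h0).mul_const (1 - cdf (gaussianReal 0 1) x)
    refine (h3.congr_of_eventuallyEq ?_).congr_deriv ?_
    · filter_upwards [Iio_mem_nhds h] with t ht
      exact if_pos (le_of_lt ht)
    · rw [steinDeriv, steinSol, if_pos h.le, Set.indicator_of_mem (Set.mem_Iic.2 h.le)]
      simp only [Pi.one_apply]
      field_simp
      ring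
  · have h3 := ((h1.const_sub 1).div h2 h0).mul_const (cdf (gaussianReal 0 1) x)
    refine (h3.congr_of_eventuallyEq ?_).congr_deriv ?_
    · filter_upwards [Ioi_mem_nhds h] with t ht
      exact if_neg (not_le.2 ht)
    · rw [steinDeriv, steinSol, if_neg (not_le.2 h),
        Set.indicator_of_notMem (show w ∉ Set.Iic x from not_le.2 h)]
      field_simp
      ring

/-- The mean value theorem needs differentiability only in the interior, so the kink `x` may be an
endpoint. -/
lemma exists_steinSol_slope {x a b : ℝ} (hab : a < b) (hx : x ∉ Set.Ioo a b) :
    ∃ ξ ∈ Set.Ioo a b, steinDeriv x ξ = (steinSol x b - steinSol x a) / (b - a) :=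
  exists_hasDerivAt_eq_slope _ _ hab (continuous_steinSol x).continuousOn fun _ ht =>
    hasDerivAt_steinSol fun h => hx (h ▸ ht)

lemma abs_steinSol_sub_le_of_lt {x a b : ℝ} (hab : a < b) :
    |steinSol x b - steinSol x a| ≤ 2 * (b - a) := by
  have key : ∀ {a b : ℝ}, a < b → x ∉ Set.Ioo a b →
      |steinSol x b - steinSol x a| ≤ 2 * (b - a) := fun {a b} hab hx => by
    obtain ⟨ξ, -, h⟩ := exists_steinSol_slope hab hx
    have h1 := abs_steinDeriv_le x ξ
    rwa [h, abs_div, abs_of_pos (sub_pos.2 hab), div_le_iff₀ (sub_pos.2 hab)] at h1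
  by_cases hx : x ∈ Set.Ioo a b
  · have h1 := key hx.1 (fun h => h.2.false)
    have h2 := key hx.2 (fun h => h.1.false)
    have h3 := abs_sub_le (steinSol x b) (steinSol x x) (steinSol x a)
    linarith
  · exact key hab hx

lemma abs_steinSol_sub_le (x a b : ℝ) : |steinSol x b - steinSol x a| ≤ 2 * |b - a| := by
  rcases lt_trichotomy a b with h | rfl | h
  · rw [abs_of_pos (sub_pos.2 h)]; exact abs_steinSol_sub_le_of_lt h
  · simp
  · rw [abs_sub_comm, abs_sub_comm b a, abs_of_pos (sub_pos.2 h)]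
    exact abs_steinSol_sub_le_of_lt h

/-- If the kink lies outside `[a, b]`, the slope is `steinDeriv x ξ` and the indicator in Stein's
equation cancels, leaving `w * f w - ξ * f ξ`. Otherwise both terms are bounded by 2, which gives
the crude error 4. -/
lemma abs_steinDeriv_sub_slope_le (x : ℝ) {a b w : ℝ} (hab : a < b) (hw : w ∈ Set.Icc a b) :
    |steinDeriv x w - (steinSol x b - steinSol x a) / (b - a)| ≤
      (2 * |w| + 6) * (b - a) + 4 * (Set.Icc a b).indicator 1 x := by
  have hpos := sub_pos.2 hab
  by_cases hx : x ∈ Set.Icc a b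
  · rw [Set.indicator_of_mem hx, Pi.one_apply]
    have h1 := abs_steinDeriv_le x w
    have h2 : |(steinSol x b - steinSol x a) / (b - a)| ≤ 2 := by
      rw [abs_div, abs_of_pos hpos, div_le_iff₀ hpos]
      exact abs_steinSol_sub_le_of_lt hab
    have h3 := abs_sub (steinDeriv x w) ((steinSol x b - steinSol x a) / (b - a))
    have : 0 ≤ (2 * |w| + 6) * (b - a) := by positivity
    linarith
  · obtain ⟨ξ, hξ, h⟩ := exists_steinSol_slope (x := x) hab fun h => hx ⟨h.1.le, h.2.le⟩
    rw [← h, Set.indicator_of_notMem hx]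
    have hind : (Set.Iic x).indicator (1 : ℝ → ℝ) w = (Set.Iic x).indicator 1 ξ := by
      rcases lt_or_ge x a with h' | h'
      · rw [Set.indicator_of_notMem, Set.indicator_of_notMem]
        · exact fun h'' => absurd (hξ.1.trans_le h'') (not_lt.2 h'.le)
        · exact fun h'' => absurd (hw.1.trans h'') (not_le.2 h')
      · have h'' : b < x := lt_of_not_ge fun h3 => hx ⟨h', h3⟩
        rw [Set.indicator_of_mem (Set.mem_Iic.2 (hw.2.trans h''.le)),
          Set.indicator_of_mem (Set.mem_Iic.2 (hξ.2.trans h'').le)]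
        rfl
    have heq : steinDeriv x w - steinDeriv x ξ =
        w * (steinSol x w - steinSol x ξ) + (w - ξ) * steinSol x ξ := by
      rw [steinDeriv, steinDeriv, hind]; ring
    have hd : |w - ξ| ≤ b - a :=
      abs_le.2 ⟨by linarith [hw.1, hξ.2], by linarith [hw.2, hξ.1]⟩
    have h4 : |w * (steinSol x w - steinSol x ξ)| ≤ |w| * (2 * (b - a)) := by
      rw [abs_mul]
      exact mul_le_mul_of_nonneg_left ((abs_steinSol_sub_le x ξ w).trans (by linarith))
        (abs_nonneg w)
    have h5 : |(w - ξ) * steinSol x ξ| ≤ (b - a) * 6 := by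
      rw [abs_mul, abs_of_nonneg (steinSol_nonneg x ξ)]
      exact mul_le_mul hd (steinSol_le x ξ) (steinSol_nonneg x ξ) hpos.le
    rw [heq]
    linarith [abs_add_le (w * (steinSol x w - steinSol x ξ)) ((w - ξ) * steinSol x ξ)]

/-! ### Berry-Esseen for random bits -/

/-- The Berry-Esseen theorem for sums of random bits. -/
theorem abs_cdf_bitSumLaw_sub_le (n : ℕ) (x : ℝ) :
    |cdf (bitSumLaw (n + 1)) (x * √(n + 1 : ℝ)) - cdf (gaussianReal 0 1) x| ≤
      44 / √(n + 1 : ℝ) := by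
  have hpos : (0 : ℝ) < n + 1 := by positivity
  set c : ℝ := √(n + 1 : ℝ) with hc
  have hc0 : 0 < c := Real.sqrt_pos.2 hpos
  have hcc : c * c = n + 1 := Real.mul_self_sqrt hpos.le
  -- A single bit is trivial since 44 exceeds 1. Otherwise `n ≥ 1`, as needed for anti-concentration
  -- of the remaining `n` bits.
  rcases Nat.eq_zero_or_pos n with rfl | hn
  · have h1 : c = 1 := by simp [hc]
    have h2 := cdf_nonneg (gaussianReal 0 1) x
    have h3 := cdf_le_one (gaussianReal 0 1) x
    have h4 := cdf_nonneg (bitSumLaw (0 + 1)) (x * c)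
    have h5 := cdf_le_one (bitSumLaw (0 + 1)) (x * c)
    rw [abs_le]
    rw [h1] at h4 h5 ⊢
    constructor <;> linarith
  have hF : cdf (bitSumLaw (n + 1)) (x * c) =
      bitMean (n + 1) (fun s => (Set.Iic x).indicator 1 (s / c)) := by
    rw [cdf_bitSumLaw]
    congr 1
    ext s
    simp only [Set.indicator, Set.mem_Iic, div_le_iff₀ hc0, Pi.one_apply]
  have hparts : bitMean (n + 1) (fun s => s / c * steinSol x (s / c)) =
      bitMean n (fun s => (steinSol x ((s + 1) / c) - steinSol x ((s - 1) / c)) /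
        ((s + 1) / c - (s - 1) / c)) := by
    have h1 : ∀ s : ℝ, s / c * steinSol x (s / c) = s * steinSol x (s / c) / c := fun s => by ring
    have h2 : ∀ s : ℝ, (s + 1) / c - (s - 1) / c = 2 / c := fun s => by ring
    have h3 : ∀ s : ℝ, (steinSol x ((s + 1) / c) - steinSol x ((s - 1) / c)) / (2 / c) =
        c * ((steinSol x ((s + 1) / c) - steinSol x ((s - 1) / c)) / 2) := fun s => by
      field_simp
    simp only [h1, h2, h3]
    rw [bitMean_div_const, bitMean_mul_self n (fun s => steinSol x (s / c)), bitMean_const_mul,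
      ← hcc]
    field_simp
  -- Stein's equation under the expectation; averaging `f'` over one bit brings both terms to `n`
  -- bits.
  have hrepr : cdf (bitSumLaw (n + 1)) (x * c) - cdf (gaussianReal 0 1) x =
      bitMean n (fun s => (steinDeriv x ((s + 1) / c) + steinDeriv x ((s - 1) / c)) / 2 -
        (steinSol x ((s + 1) / c) - steinSol x ((s - 1) / c)) /
        ((s + 1) / c - (s - 1) / c)) := by
    rw [bitMean_sub, ← hparts, ← bitMean_succ' n (fun s => steinDeriv x (s / c)), hF]
    simp only [steinDeriv]
    rw [bitMean_add, bitMean_sub, bitMean_const]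
    ring
  have hbound : ∀ s : ℝ, |(steinDeriv x ((s + 1) / c) + steinDeriv x ((s - 1) / c)) / 2 -
        (steinSol x ((s + 1) / c) - steinSol x ((s - 1) / c)) / ((s + 1) / c - (s - 1) / c)| ≤
      4 / (c * c) * |s| + (4 / (c * c) + 12 / c +
        4 * (Set.Icc (x * c - 1) (x * c + 1)).indicator 1 s) := fun s => by
    have hlt : (s - 1) / c < (s + 1) / c := by gcongr; linarith
    have h1 := abs_steinDeriv_sub_slope_le x hlt (Set.right_mem_Icc.2 hlt.le)
    have h2 := abs_steinDeriv_sub_slope_le x hlt (Set.left_mem_Icc.2 hlt.le)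
    -- The kink lies in the difference interval exactly when the walk is within 1 of `x * c`.
    have h3 : (Set.Icc ((s - 1) / c) ((s + 1) / c)).indicator (1 : ℝ → ℝ) x =
        (Set.Icc (x * c - 1) (x * c + 1)).indicator 1 s := by
      simp only [Set.indicator, Set.mem_Icc, div_le_iff₀ hc0, le_div_iff₀ hc0, Pi.one_apply]
      congr 1
      rw [eq_iff_iff]
      constructor <;> rintro ⟨h, h'⟩ <;> constructor <;> linarith
    have h4 : (s + 1) / c - (s - 1) / c = 2 / c := by ring
    rw [h3] at h1 h2
    set D := (steinSol x ((s + 1) / c) - steinSol x ((s - 1) / c)) /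
      ((s + 1) / c - (s - 1) / c) with hD
    rw [h4] at h1 h2
    have h5 : |(s + 1) / c| ≤ (|s| + 1) / c := by
      rw [abs_div, abs_of_pos hc0]; gcongr
      exact (abs_add_le s 1).trans (by simp)
    have h6 : |(s - 1) / c| ≤ (|s| + 1) / c := by
      rw [abs_div, abs_of_pos hc0]; gcongr
      exact (abs_sub s 1).trans (by simp)
    have h7 : ∀ u : ℝ, |u| ≤ (|s| + 1) / c → (2 * |u| + 6) * (2 / c) ≤
        4 / (c * c) * |s| + 4 / (c * c) + 12 / c := fun u hu => by
      calc (2 * |u| + 6) * (2 / c) ≤ (2 * ((|s| + 1) / c) + 6) * (2 / c) := by gcongr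
        _ = _ := by field_simp; ring
    have h8 : (steinDeriv x ((s + 1) / c) + steinDeriv x ((s - 1) / c)) / 2 - D =
        ((steinDeriv x ((s + 1) / c) - D) + (steinDeriv x ((s - 1) / c) - D)) / 2 := by ring
    rw [h8, abs_div, abs_of_pos (two_pos (α := ℝ))]
    have h9 := abs_add_le (steinDeriv x ((s + 1) / c) - D) (steinDeriv x ((s - 1) / c) - D)
    have h10 := h7 _ h5
    have h11 := h7 _ h6
    linarith
  rw [hrepr]
  refine (abs_bitMean_le n hbound).trans ?_
  rw [bitMean_add, bitMean_const_mul, bitMean_add, bitMean_const, bitMean_const_mul]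
  obtain ⟨m, rfl⟩ : ∃ m, n = m + 1 := ⟨n - 1, by omega⟩
  have hconc := bitMean_indicator_Icc_le m (x * c)
  have habs := bitMean_abs_le (m + 1)
  have hc1 : 1 ≤ c := by
    rw [hc, Real.one_le_sqrt]; push_cast; linarith [(Nat.cast_nonneg m : (0 : ℝ) ≤ m)]
  have hle : √((m + 1 : ℕ) : ℝ) ≤ c := Real.sqrt_le_sqrt (by linarith)
  have hm : (3 : ℝ) / √(m + 1 : ℝ) ≤ 6 / c := by
    have h1 : 0 < √(m + 1 : ℝ) := Real.sqrt_pos.2 (by positivity)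
    rw [div_le_div_iff₀ h1 hc0]
    -- Anti-concentration is for `m + 1` bits while `c = √(m + 2)`; the mismatch costs a factor 2.
    have h2 : c ≤ 2 * √(m + 1 : ℝ) := by
      rw [hc, Real.sqrt_le_left (by positivity), mul_pow, Real.sq_sqrt (by positivity)]
      push_cast; linarith [(Nat.cast_nonneg m : (0 : ℝ) ≤ m)]
    linarith
  have e1 : 4 / (c * c) * bitMean (m + 1) (fun s => |s|) ≤ 4 / c := by
    calc 4 / (c * c) * bitMean (m + 1) (fun s => |s|) ≤ 4 / (c * c) * c := by
          gcongr; exact habs.trans hle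
      _ = 4 / c := by field_simp
  have e2 : 4 / (c * c) ≤ 4 / c := by
    gcongr
    nlinarith
  have e3 : 44 / c = 4 / c + (4 / c + 12 / c + 4 * (6 / c)) := by ring
  rw [e3]
  linarith

/-! ### The quantile coupling -/

/-- The probability integral transform for the standard Gaussian. -/
lemma gaussianReal_std_cdf_le {t : ℝ} (h0 : 0 ≤ t) (h1 : t ≤ 1) :
    (gaussianReal 0 1).real {g | cdf (gaussianReal 0 1) g ≤ t} = t := by
  -- `Ψ` never attains 0 or 1, so these levels have no preimage `z`.
  rcases h0.eq_or_lt with rfl | h0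
  · have : {g : ℝ | cdf (gaussianReal 0 1) g ≤ 0} = ∅ :=
      Set.eq_empty_of_forall_notMem fun g hg => not_lt.2 hg (cdf_gaussianReal_std_pos g)
    simp [this]
  rcases h1.eq_or_lt with rfl | h1
  · have : {g : ℝ | cdf (gaussianReal 0 1) g ≤ 1} = Set.univ :=
      Set.eq_univ_of_forall fun g => cdf_le_one _ g
    simp [this]
  · obtain ⟨a, ha⟩ := ((tendsto_cdf_atBot (gaussianReal 0 1)).eventually_lt_const h0).exists
    obtain ⟨b, hb⟩ := ((tendsto_cdf_atTop (gaussianReal 0 1)).eventually_const_lt h1).exists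
    obtain ⟨z, hz⟩ := mem_range_of_exists_le_of_exists_ge continuous_cdf_gaussianReal_std
      ⟨a, ha.le⟩ ⟨b, hb.le⟩
    have : {g : ℝ | cdf (gaussianReal 0 1) g ≤ t} = Set.Iic z := by
      ext g
      rw [Set.mem_ofPred_eq, ← hz]
      exact strictMono_cdf_gaussianReal_std.le_iff_le
    rw [this, ← cdf_eq_real]
    exact hz

/-- The quantile function of a probability measure on `ℝ`. -/
noncomputable def quantile (ν : Measure ℝ) (u : ℝ) : ℝ := sInf {h | u ≤ cdf ν h}

/-- For `0 < u < 1` the set is nonempty and bounded below, so `sInf` is a true infimum; right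
continuity of the distribution function puts it in the set. -/
lemma quantile_le_iff (ν : Measure ℝ) {u : ℝ} (h0 : 0 < u) (h1 : u < 1) (h : ℝ) :
    quantile ν u ≤ h ↔ u ≤ cdf ν h := by
  obtain ⟨a, ha⟩ := ((tendsto_cdf_atBot ν).eventually_lt_const h0).exists
  obtain ⟨b, hb⟩ := ((tendsto_cdf_atTop ν).eventually_const_lt h1).exists
  have hne : {h | u ≤ cdf ν h}.Nonempty := ⟨b, hb.le⟩
  have hbdd : BddBelow {h | u ≤ cdf ν h} :=
    ⟨a, fun y hy => le_of_not_gt fun hlt => (hy.trans (monotone_cdf ν hlt.le)).not_gt ha⟩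
  refine ⟨fun hq => ?_, fun hu => csInf_le hbdd hu⟩
  refine le_trans ?_ (monotone_cdf ν hq)
  have hr : Filter.Tendsto (cdf ν) (nhdsWithin (quantile ν u) (Set.Ioi (quantile ν u)))
      (nhds (cdf ν (quantile ν u))) :=
    ((cdf ν).right_continuous _).mono_left (nhdsWithin_mono _ Set.Ioi_subset_Ici_self)
  refine ge_of_tendsto hr ?_
  filter_upwards [self_mem_nhdsWithin] with y hy
  obtain ⟨z, hz, hzy⟩ := exists_lt_of_csInf_lt hne hy
  exact le_trans hz (monotone_cdf ν hzy.le)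

/-- The quantile transform sends the standard Gaussian to any given law. -/
noncomputable def gaussianTransport (ν : Measure ℝ) (g : ℝ) : ℝ :=
  quantile ν (cdf (gaussianReal 0 1) g)

lemma gaussianTransport_le_iff (ν : Measure ℝ) (g h : ℝ) :
    gaussianTransport ν g ≤ h ↔ cdf (gaussianReal 0 1) g ≤ cdf ν h :=
  quantile_le_iff ν (cdf_gaussianReal_std_pos g) (cdf_gaussianReal_std_lt_one g) h

lemma monotone_gaussianTransport (ν : Measure ℝ) : Monotone (gaussianTransport ν) := by
  intro a b hab
  rw [gaussianTransport_le_iff]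
  exact (monotone_cdf _ hab).trans ((gaussianTransport_le_iff ν b _).1 le_rfl)

lemma map_gaussianTransport (ν : Measure ℝ) [IsProbabilityMeasure ν] :
    (gaussianReal 0 1).map (gaussianTransport ν) = ν := by
  have hm := (monotone_gaussianTransport ν).measurable
  have : IsProbabilityMeasure ((gaussianReal 0 1).map (gaussianTransport ν)) :=
    Measure.isProbabilityMeasure_map hm.aemeasurable
  refine Measure.eq_of_cdf _ _ (StieltjesFunction.ext fun h => ?_)
  rw [cdf_eq_real, map_measureReal_apply hm measurableSet_Iic]
  have : gaussianTransport ν ⁻¹' Set.Iic h = {g | cdf (gaussianReal 0 1) g ≤ cdf ν h} := by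
    ext g
    exact gaussianTransport_le_iff ν g h
  rw [this, gaussianReal_std_cdf_le (cdf_nonneg _ _) (cdf_le_one _ _)]

/-- The coupling of the standard Gaussian with `ν` by quantile matching. -/
noncomputable def quantileCoupling (ν : Measure ℝ) : Measure (ℝ × ℝ) :=
  (gaussianReal 0 1).map fun g => (g, gaussianTransport ν g)

lemma measurable_quantileCoupling (ν : Measure ℝ) :
    Measurable fun g => (g, gaussianTransport ν g) :=
  measurable_id.prodMk (monotone_gaussianTransport ν).measurable

lemma isCoupling_quantileCoupling (ν : Measure ℝ) [IsProbabilityMeasure ν] :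
    IsCoupling (quantileCoupling ν) (gaussianReal 0 1) ν where
  isProbabilityMeasure :=
    Measure.isProbabilityMeasure_map (measurable_quantileCoupling ν).aemeasurable
  fst_eq := by
    rw [quantileCoupling, Measure.fst, Measure.map_map measurable_fst
      (measurable_quantileCoupling ν)]
    exact Measure.map_id
  snd_eq := by
    rw [quantileCoupling, Measure.snd, Measure.map_map measurable_snd
      (measurable_quantileCoupling ν)]
    exact map_gaussianTransport ν

/-- Anything strictly below the quantile fails the equivalence `gaussianTransport_le_iff`; the
spacing of the atoms plays no role. -/
lemma cdf_gaussianTransport_sub_lt (ν : Measure ℝ) {d : ℝ} (hd : 0 < d) (g : ℝ) :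
    cdf ν (gaussianTransport ν g - d) < cdf (gaussianReal 0 1) g := by
  rw [← not_le, ← gaussianTransport_le_iff]
  linarith

lemma le_cdf_gaussianTransport (ν : Measure ℝ) (g : ℝ) :
    cdf (gaussianReal 0 1) g ≤ cdf ν (gaussianTransport ν g) :=
  (gaussianTransport_le_iff ν g _).1 le_rfl

lemma matchesQuantiles_quantileCoupling (N : ℕ) :
    MatchesQuantiles N (quantileCoupling (bitSumLaw N)) := by
  have hS : MeasurableSet {p : ℝ × ℝ | cdf (bitSumLaw N) (p.2 - 2) < cdf (gaussianReal 0 1) p.1 ∧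
      cdf (gaussianReal 0 1) p.1 ≤ cdf (bitSumLaw N) p.2} := by
    have h1 := (monotone_cdf (bitSumLaw N)).measurable
    have h2 := (monotone_cdf (gaussianReal 0 1)).measurable
    exact (measurableSet_lt (h1.comp (measurable_snd.sub_const 2)) (h2.comp measurable_fst)).inter
      (measurableSet_le (h2.comp measurable_fst) (h1.comp measurable_snd))
  rw [MatchesQuantiles, quantileCoupling,
    ae_map_iff (measurable_quantileCoupling _).aemeasurable hS]
  exact ae_of_all _ fun g =>
    ⟨cdf_gaussianTransport_sub_lt _ two_pos g, le_cdf_gaussianTransport _ g⟩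

/-! ### From close distribution functions to close points -/

lemma cdf_gaussianReal_std_sub_le {a b : ℝ} (hab : a ≤ b) :
    cdf (gaussianReal 0 1) b - cdf (gaussianReal 0 1) a ≤ b - a := by
  rcases hab.eq_or_lt with rfl | hab
  · simp
  obtain ⟨ξ, -, h⟩ := exists_hasDerivAt_eq_slope _ _ hab
    continuous_cdf_gaussianReal_std.continuousOn fun t _ => hasDerivAt_cdf_gaussianReal_std t
  have := gaussianPDFReal_std_le_one ξ
  rw [h, div_le_one (sub_pos.2 hab)] at this
  exact this

/-- Between `a` and `b` the smaller tail stays at least `m`, since one tail increases and the other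
decreases. So the density there is at least `m / 6`, and the mean value theorem applies. -/
lemma le_cdf_gaussianReal_std_sub {a b m : ℝ} (hab : a ≤ b) (ha : m ≤ gaussianTail a)
    (hb : m ≤ gaussianTail b) :
    m * (b - a) ≤ 6 * (cdf (gaussianReal 0 1) b - cdf (gaussianReal 0 1) a) := by
  rcases hab.eq_or_lt with rfl | hab
  · simp
  obtain ⟨ξ, hξ, h⟩ := exists_hasDerivAt_eq_slope _ _ hab
    continuous_cdf_gaussianReal_std.continuousOn fun t _ => hasDerivAt_cdf_gaussianReal_std t
  have h1 : m ≤ gaussianTail ξ :=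
    le_min ((ha.trans (min_le_left _ _)).trans (monotone_cdf _ hξ.1.le))
      ((hb.trans (min_le_right _ _)).trans
        (sub_le_sub_left (monotone_cdf _ hξ.2.le) 1))
  have h2 := h1.trans (gaussianTail_le ξ)
  rw [h, ← mul_div_assoc, le_div_iff₀ (sub_pos.2 hab)] at h2
  exact h2

lemma mul_abs_sub_le_of_gaussianTail {a b m : ℝ} (ha : m ≤ gaussianTail a)
    (hb : m ≤ gaussianTail b) :
    m * |a - b| ≤ 6 * |cdf (gaussianReal 0 1) a - cdf (gaussianReal 0 1) b| := by
  rcases le_total a b with h | h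
  · rw [abs_sub_comm, abs_sub_comm (cdf _ _), abs_of_nonneg (sub_nonneg.2 h),
      abs_of_nonneg (sub_nonneg.2 (monotone_cdf _ h))]
    exact le_cdf_gaussianReal_std_sub h ha hb
  · rw [abs_of_nonneg (sub_nonneg.2 h), abs_of_nonneg (sub_nonneg.2 (monotone_cdf _ h))]
    exact le_cdf_gaussianReal_std_sub h hb ha

lemma gaussianTail_sub_le (a b : ℝ) :
    gaussianTail a - |cdf (gaussianReal 0 1) a - cdf (gaussianReal 0 1) b| ≤ gaussianTail b := by
  have h1 := le_abs_self (cdf (gaussianReal 0 1) a - cdf (gaussianReal 0 1) b)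
  have h2 := neg_abs_le (cdf (gaussianReal 0 1) a - cdf (gaussianReal 0 1) b)
  have h3 : gaussianTail a ≤ cdf (gaussianReal 0 1) a := min_le_left _ _
  have h4 : gaussianTail a ≤ 1 - cdf (gaussianReal 0 1) a := min_le_right _ _
  exact le_min (by linarith) (by linarith)

/-- `Ψ g` is uniform on `[0, 1]`, and the tail is at least `t` when `Ψ g` lies in `[t, 1 - t]`. -/
lemma le_gaussianReal_std_gaussianTail {t : ℝ} (h0 : 0 ≤ t) :
    1 - 2 * t ≤ (gaussianReal 0 1).real {g | t ≤ gaussianTail g} := by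
  rcases le_total 1 (2 * t) with h | h
  · exact (by linarith : 1 - 2 * t ≤ 0).trans measureReal_nonneg
  have hsub : {g | cdf (gaussianReal 0 1) g ≤ 1 - t} \ {g | cdf (gaussianReal 0 1) g ≤ t} ⊆
      {g | t ≤ gaussianTail g} := fun g hg => by
    have h1 : cdf (gaussianReal 0 1) g ≤ 1 - t := hg.1
    have h2 : ¬ cdf (gaussianReal 0 1) g ≤ t := hg.2
    exact le_min (not_le.1 h2).le (by linarith)
  have hm : MeasurableSet {g | cdf (gaussianReal 0 1) g ≤ t} :=
    measurableSet_le (monotone_cdf (gaussianReal 0 1)).measurable measurable_const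
  have hss : {g | cdf (gaussianReal 0 1) g ≤ t} ⊆ {g | cdf (gaussianReal 0 1) g ≤ 1 - t} :=
    fun g hg => le_trans (show _ ≤ t from hg) (by linarith : t ≤ 1 - t)
  refine le_trans (le_of_eq ?_) (measureReal_mono hsub)
  rw [measureReal_sdiff hss hm, gaussianReal_std_cdf_le (by linarith) (by linarith),
    gaussianReal_std_cdf_le h0 (by linarith)]
  ring

/-- Quantile matching puts `Ψ g` between `F (h - 2)` and `F h`. Berry-Esseen replaces each by `Ψ` at
the rescaled point, at cost `44 / c`, and these two values differ by at most `2 / c`. -/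
lemma abs_cdf_sub_cdf_gaussianTransport_le (n : ℕ) (g : ℝ) :
    |cdf (gaussianReal 0 1) g - cdf (gaussianReal 0 1)
      (gaussianTransport (bitSumLaw (n + 1)) g / √(n + 1 : ℝ))| ≤ 46 / √(n + 1 : ℝ) := by
  have hc : 0 < √(n + 1 : ℝ) := Real.sqrt_pos.2 (by positivity)
  set c := √(n + 1 : ℝ)
  set h := gaussianTransport (bitSumLaw (n + 1)) g
  have h1 := le_cdf_gaussianTransport (bitSumLaw (n + 1)) g
  have h2 := cdf_gaussianTransport_sub_lt (bitSumLaw (n + 1)) two_pos g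
  have h3 := abs_cdf_bitSumLaw_sub_le n (h / c)
  have h4 := abs_cdf_bitSumLaw_sub_le n ((h - 2) / c)
  rw [div_mul_cancel₀ _ hc.ne'] at h3 h4
  have h5 : (h - 2) / c ≤ h / c := by gcongr; linarith
  have h6 := cdf_gaussianReal_std_sub_le h5
  have h7 : h / c - (h - 2) / c = 2 / c := by ring
  have h8 : 46 / c = 44 / c + 2 / c := by ring
  have h9 : 0 < 2 / c := by positivity
  rw [abs_le] at h3 h4 ⊢
  constructor <;> linarith [h3.1, h3.2, h4.1, h4.2]

theorem mainTheorem6 :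
    ∃ C : ℝ, 0 < C ∧ ∀ N : ℕ, 1 ≤ N →
      ∃ γ : Measure (ℝ × ℝ),
        IsCoupling γ (gaussianReal 0 1) (bitSumLaw N) ∧
        MatchesQuantiles N γ ∧
        1 - C * (N : ℝ) ^ (-(1 / 4) : ℝ) ≤
          γ.real {p : ℝ × ℝ | |p.1 - p.2 / √(N : ℝ)| ≤ C * (N : ℝ) ^ (-(1 / 4) : ℝ)} := by
  -- With `s = N^(-1/4)` the distribution functions differ by at most `46 * s²`. Requiring tail `92
  -- * s` at `g` loses mass `184 * s` and leaves at least `46 * s` at the other point, so the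
  -- distance is at most `6 * s`. The lost mass dictates 184.
  refine ⟨184, by norm_num, fun N hN => ⟨quantileCoupling (bitSumLaw N),
    isCoupling_quantileCoupling _, matchesQuantiles_quantileCoupling N, ?_⟩⟩
  obtain ⟨n, rfl⟩ : ∃ n, N = n + 1 := ⟨N - 1, by omega⟩
  have hNpos : (0 : ℝ) < ((n + 1 : ℕ) : ℝ) := by positivity
  have hN1 : (1 : ℝ) ≤ ((n + 1 : ℕ) : ℝ) := by exact_mod_cast hN
  set s : ℝ := ((n + 1 : ℕ) : ℝ) ^ (-(1 / 4) : ℝ) with hs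
  have hs0 : 0 < s := Real.rpow_pos_of_pos hNpos _
  have hs1 : s ≤ 1 := Real.rpow_le_one_of_one_le_of_nonpos hN1 (by norm_num)
  have hss : 46 / √((n + 1 : ℕ) : ℝ) = 46 * (s * s) := by
    rw [hs, ← Real.rpow_add hNpos, Real.sqrt_eq_rpow, div_eq_mul_inv, ← Real.rpow_neg hNpos.le]
    norm_num
  have hmeas : MeasurableSet {p : ℝ × ℝ | |p.1 - p.2 / √((n + 1 : ℕ) : ℝ)| ≤ 184 * s} :=
    measurableSet_le (by fun_prop) measurable_const
  rw [quantileCoupling, map_measureReal_apply (measurable_quantileCoupling _) hmeas]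
  have h1 := le_gaussianReal_std_gaussianTail (t := 92 * s) (by positivity)
  refine (by linarith : 1 - 184 * s ≤ 1 - 2 * (92 * s)).trans (h1.trans (measureReal_mono ?_))
  intro g hg
  have h2 := abs_cdf_sub_cdf_gaussianTransport_le n g
  rw [← Nat.cast_succ, Nat.succ_eq_add_one, hss] at h2
  have h3 : 92 * s ≤ gaussianTail g := hg
  have h4 := gaussianTail_sub_le g
    (gaussianTransport (bitSumLaw (n + 1)) g / √((n + 1 : ℕ) : ℝ))
  have hs2 : s * s ≤ s := mul_le_of_le_one_left hs0.le hs1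
  have h5 := mul_abs_sub_le_of_gaussianTail (m := 46 * s) (by linarith : _ ≤ gaussianTail g)
    (by linarith : _ ≤ gaussianTail
      (gaussianTransport (bitSumLaw (n + 1)) g / √((n + 1 : ℕ) : ℝ)))
  have h6 : 46 * s * |g - gaussianTransport (bitSumLaw (n + 1)) g / √((n + 1 : ℕ) : ℝ)| ≤
      46 * s * (6 * s) := h5.trans (by linarith)
  have h7 := le_of_mul_le_mul_left h6 (by positivity)
  exact h7.trans (by linarith)
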